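/- Let $n\ge 0$ and work with discrete-time signals: the extended space consists of all sequences $x=(x(0),x(1),\dots)$ in $\mathbb R^n$, $\|x\|_\infty=\sup_t\max_i|x_i(t)|$, and $P_T$ is truncation to times $t\le T$. For a linear operator $\mathbf H$ on sequences let $\|\mathbf H\|_{1}=\|\mathbf H\|_{\infty,\infty}=\sup_T\sup_{x\ne0}\|P_T\mathbf Hx\|_\infty/\|P_Tx\|_\infty\in[0,\infty]$ (with $0/0:=0$); $\mathbf H$ is stable if this is finite, causal if $P_T\mathbf H=P_T\mathbf HP_T$ for all $T\geq 0$, and time-invariant if it commutes with the unit delay. Write $\mathbf H_{ij}$ for the scalar entries of $\mathbf H$, and $M_{\mathbf H}=(\|\mathbf H_{ij}\|_1)_{ij}$ for the magnitude matrix of a stable $\mathbf H$. Let $\mathscr D$ be the set of stable causal linear (possibly time-varying) operators $\boldsymbol\Delta$ with $n$ inputs and outputs whose off-diagonal entries are zero, with diagonal entries $\boldsymbol\delta_1,\dots,\boldsymbol\delta_n$. Let $\mathscr C\subset\mathbb R^{n\times n}$ be the set of diagonal matrices with non-negative diagonal entries, and $\mathcal D\subset\mathbb R^{n\times n}$ the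 set of diagonal matrices with positive diagonal entries. For a linear system $\mathbf G$ with $n$ inputs and outputs and for a matrix $M\in\mathbb R^{n\times n}$ define, with values in $[0,\infty]$, $$\mu_{\mathscr D}(\mathbf G)=\frac1{\inf\{\|\boldsymbol\Delta\|_{\infty,\infty}:\boldsymbol\Delta\in\mathscr D,\ (I-\mathbf G\boldsymbol\Delta)^{-1}\text{ unstable}\}},\qquad \nu_{\mathscr D}(\mathbf G)=\frac1{\inf\{\sum_{i=1}^n\|\boldsymbol\delta_i\|_1:\boldsymbol\Delta\in\mathscr D,\ (I-\mathbf G\boldsymbol\Delta)^{-1}\text{ unstable}\}},$$ $$\nu_{\mathscr C}(M)=\frac1{\inf\{\sum_{i=1}^n|\delta_{i}|:\Delta=\operatorname{diag}(\delta_1,\dots,\delta_n)\in\mathscr C,\ I-M\Delta\text{ singular}\}},$$ where $\inf\emptyset=\infty$, $1/\infty=0$, $1/0=\infty$, and "$(I-\mathbf G\boldsymbol\Delta)^{-1}$ unstable" means that $I-\mathbf G\boldsymbol\Delta$ has no causal and stable two-sided inverse on the space of all sequences. **Proposition.** Let $\mathbf G$ be a stable causal linear system with $n$ inputs and outputs.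 Then: 1. if $\mathbf G$ is time-invariant, $\nu_{\mathscr D}(\mathbf G)=\nu_{\mathscr C}(M_{\mathbf G})$; 2. $\nu_{\mathscr D}(a\mathbf G)=|a|\,\nu_{\mathscr D}(\mathbf G)$ for all $a\in\mathbb R$; 3. $\nu_{\mathscr D}(D\mathbf GD^{-1})=\nu_{\mathscr D}(\mathbf G)$ for all $D\in\mathcal D$; 4. $\mu_{\mathscr D}(\mathbf G)/n\le\nu_{\mathscr D}(\mathbf G)\le\mu_{\mathscr D}(\mathbf G)$ (for $n=0$ all quantities are $0$ and $0/0:=0$). In 2 and 4 the arithmetic is that of $[0,\infty]$, with $0\cdot\infty=0$. -/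

import Mathlib

open scoped ENNReal

namespace NuMeasure

/-- Discrete-time linear systems mapping input sequences in `E` to output sequences in `F`.
The extended space of signals consists of all one-sided sequences. -/
abbrev Sys (E F : Type*) [AddCommGroup E] [Module ℝ E] [AddCommGroup F] [Module ℝ F] :=
  (ℕ → E) →ₗ[ℝ] (ℕ → F)

/-- The norm `‖x‖_∞ = sup_t |x(t)|_∞ ∈ [0, ∞]` of a signal. For `E = Fin n → ℝ` the norm of
`x t` is the max norm, for `E = ℝ` the absolute value. -/
noncomputable def sigNorm {E : Type*} [NormedAddCommGroup E] (x : ℕ → E) : ℝ≥0∞ :=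
  ⨆ t, ‖x t‖ₑ

/-- The truncation operator `P_T x = (x(0), …, x(T), 0, 0, …)`. -/
def trunc {E : Type*} [Zero E] (T : ℕ) (x : ℕ → E) : ℕ → E :=
  fun t => if t ≤ T then x t else 0

/-- The delay operator `x ↦ (0, x(0), x(1), …)`. -/
def delay {E : Type*} [Zero E] (x : ℕ → E) : ℕ → E
  | 0 => 0
  | t + 1 => x t

section
variable {E F : Type*} [NormedAddCommGroup E] [NormedSpace ℝ E]
  [NormedAddCommGroup F] [NormedSpace ℝ F]

/-- `H` is causal: `P_T H = P_T H P_T` for all `T`. -/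
def Causal (H : Sys E F) : Prop :=
  ∀ (T : ℕ) (x : ℕ → E), trunc T (H x) = trunc T (H (trunc T x))

/-- `H` is time-invariant: it commutes with the delay operator. -/
def TimeInvariant (H : Sys E F) : Prop :=
  ∀ x : ℕ → E, H (delay x) = delay (H x)

/-- The induced norm `sup_T sup_{x ≠ 0} ‖P_T H x‖_∞ / ‖P_T x‖_∞ ∈ [0, ∞]`
(`0 / 0 = 0`; the denominator is always finite). -/
noncomputable def indNorm (H : Sys E F) : ℝ≥0∞ :=
  ⨆ (T : ℕ) (x : ℕ → E) (_ : x ≠ 0), sigNorm (trunc T (H x)) / sigNorm (trunc T x)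

/-- `ℓ_∞` stability. -/
def Stable (H : Sys E F) : Prop := indNorm H < ∞

/-- `H` has a causal and stable two-sided inverse on the extended signal space. -/
def HasStableInverse (H : Sys E E) : Prop :=
  ∃ K : Sys E E, Causal K ∧ Stable K ∧ K ∘ₗ H = LinearMap.id ∧ H ∘ₗ K = LinearMap.id

end

/-- Systems with `n` inputs and `n` outputs. -/
abbrev MSys (n : ℕ) := Sys (Fin n → ℝ) (Fin n → ℝ)

/-- The scalar system `H_ij` from the `j`-th input to the `i`-th output. -/
noncomputable def entry {n : ℕ} (H : MSys n) (i j : Fin n) : Sys ℝ ℝ :=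
  (LinearMap.proj (R := ℝ) (φ := fun _ : Fin n => ℝ) i).compLeft ℕ ∘ₗ H ∘ₗ
    (LinearMap.single ℝ (fun _ : Fin n => ℝ) j).compLeft ℕ

/-- The magnitude matrix `(‖H_ij‖_1)_{ij}` (meaningful for stable `H`). -/
noncomputable def magMatrix {n : ℕ} (H : MSys n) : Matrix (Fin n) (Fin n) ℝ :=
  fun i j => (indNorm (entry H i j)).toReal

/-- The memoryless system `(D x)(t) = D x(t)` given by a constant matrix. -/
def static {n : ℕ} (D : Matrix (Fin n) (Fin n) ℝ) : MSys n :=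
  D.mulVecLin.compLeft ℕ

/-- The uncertainty set: stable causal linear (possibly time-varying) systems whose off-diagonal
entries are zero. -/
def uncertainty (n : ℕ) : Set (MSys n) :=
  {Δ | Causal Δ ∧ Stable Δ ∧ ∀ i j, i ≠ j → entry Δ i j = 0}

/-- Non-negative diagonal matrices. -/
def nonnegDiag (n : ℕ) : Set (Matrix (Fin n) (Fin n) ℝ) :=
  {Δ | ∃ d : Fin n → ℝ, (∀ i, 0 ≤ d i) ∧ Δ = Matrix.diagonal d}

/-- Diagonal matrices with positive diagonal entries. -/
def posDiag (n : ℕ) : Set (Matrix (Fin n) (Fin n) ℝ) :=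
  {D | ∃ d : Fin n → ℝ, (∀ i, 0 < d i) ∧ D = Matrix.diagonal d}

/-- The uncertainties `Δ` for which `(I - G Δ)⁻¹` is unstable, that is, for which `I - G Δ` has no
causal stable inverse. -/
def destabilizing {n : ℕ} (G : MSys n) : Set (MSys n) :=
  {Δ | Δ ∈ uncertainty n ∧ ¬ HasStableInverse (LinearMap.id - G ∘ₗ Δ)}

/-- `μ(G)`, with values in `[0, ∞]`; it is `0` if no uncertainty is destabilizing. -/
noncomputable def mu {n : ℕ} (G : MSys n) : ℝ≥0∞ :=
  (⨅ Δ ∈ destabilizing G, indNorm Δ)⁻¹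

/-- `ν(G)`, with values in `[0, ∞]`; it is `0` if no uncertainty is destabilizing. -/
noncomputable def nu {n : ℕ} (G : MSys n) : ℝ≥0∞ :=
  (⨅ Δ ∈ destabilizing G, ∑ i, indNorm (entry Δ i i))⁻¹

/-- `ν` of a constant matrix with respect to the non-negative diagonal matrices: for constant
matrices, `(I - M Δ)⁻¹` is unstable exactly if `I - M Δ` is singular, and the norm of a scalar gain
is its absolute value. -/
noncomputable def nuConst {n : ℕ} (M : Matrix (Fin n) (Fin n) ℝ) : ℝ≥0∞ :=
  (⨅ Δ ∈ {Δ | Δ ∈ nonnegDiag n ∧ ¬ IsUnit (1 - M * Δ)}, ∑ i, ‖Δ i i‖ₑ)⁻¹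

end NuMeasure

namespace NuMeasure

/-! Claims 2 and 3 compare destabilizing sets. Scaling `G` by `a ≠ 0` is undone by scaling `Δ`, and
a constant diagonal matrix commutes with every diagonal `Δ`, so conjugating `G` by it conjugates `I
- GΔ`. Claim 4 is max ≤ sum ≤ n · max for the gains of the diagonal entries.

Claim 1, upper bound on `ν(G)` (`nu_le_nuConst`): let `Δ` have gains `d` and put `A = M diag(d)`. If
`I - sA` were invertible for all `s ∈ [0, 1]`, continuity in `s` would make `v = (I - A)⁻¹ 1`
positive (`exists_weight`). Since `Av < v`, the system `GΔ` is a contraction in the max norm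
weighted by `v`, and its Neumann series gives a stable inverse (`hasStableInverse_of_weight`). So a
destabilizing `Δ` makes some `I - M diag(s d)` with `s ≤ 1` singular, at no larger cost.

Claim 1, lower bound (`nuConst_le_nu`): if `I - M diag(d)` is singular, the absolute values `x` of a
kernel vector satisfy `x ≤ M diag(d) x`. For any `c > 1`, an input whose signs match the impulse
responses, aimed at one output channel after another, makes the outputs of `G` grow geometrically
(`TimeInvariant.exists_unbounded`). Time-varying gains of size at most `c d` acting on past outputs
reproduce this input, so the loop turns a bounded signal into an unbounded one
(`exists_destabilizing_of_unbounded`). Finally `c → 1`. -/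

theorem sigNorm_trunc_le_iff {E : Type*} [NormedAddCommGroup E] {x : ℕ → E} {T : ℕ} {B : ℝ≥0∞} :
    sigNorm (trunc T x) ≤ B ↔ ∀ s ≤ T, ‖x s‖ₑ ≤ B := by
  simp only [sigNorm, trunc, iSup_le_iff]
  refine ⟨fun h s hs => by simpa [hs] using h s, fun h s => ?_⟩
  split_ifs with hs
  · exact h s hs
  · simp

theorem sigNorm_trunc_ne_top {E : Type*} [NormedAddCommGroup E] (x : ℕ → E)
    (T : ℕ) : sigNorm (trunc T x) ≠ ∞ := by
  refine ne_top_of_le_ne_top (b := ∑ s ∈ Finset.range (T + 1), ‖x s‖ₑ) ?_ ?_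
  · simp [ENNReal.sum_eq_top]
  · refine sigNorm_trunc_le_iff.2 fun s hs => ?_
    exact Finset.single_le_sum (f := fun s => ‖x s‖ₑ) (fun _ _ => bot_le)
      (Finset.mem_range.2 (by omega))

/-! ### Induced norms, causality and the small gain theorem -/

section Norms

variable {E F G : Type*} [NormedAddCommGroup E] [NormedSpace ℝ E]
  [NormedAddCommGroup F] [NormedSpace ℝ F] [NormedAddCommGroup G] [NormedSpace ℝ G]

/-- A finite bound on the induced norm is a pointwise bound in terms of the past input. -/
theorem indNorm_le_iff {H : Sys E F} {C : ℝ} (hC : 0 ≤ C) :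
    indNorm H ≤ ENNReal.ofReal C ↔
      ∀ (T : ℕ) (x : ℕ → E) (B : ℝ), (∀ s ≤ T, ‖x s‖ ≤ B) → ‖H x T‖ ≤ C * B := by
  -- The truncation of some `x ≠ 0` can vanish. As the bound is finite, division by zero in `ℝ≥0∞`
  -- then forces the numerator to vanish too, as the product form does.
  have key : ∀ (T : ℕ) (x : ℕ → E),
      sigNorm (trunc T (H x)) / sigNorm (trunc T x) ≤ ENNReal.ofReal C ↔
        sigNorm (trunc T (H x)) ≤ ENNReal.ofReal C * sigNorm (trunc T x) := fun T x =>
    ENNReal.div_le_iff_le_mul (Or.inr ENNReal.ofReal_ne_top) (Or.inl (sigNorm_trunc_ne_top x T))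
  simp only [indNorm, iSup_le_iff, key]
  constructor
  · intro h T x B hB
    have hB0 : 0 ≤ B := (norm_nonneg _).trans (hB 0 (Nat.zero_le _))
    by_cases hx : x = 0
    · simp only [hx, map_zero, Pi.zero_apply, norm_zero]; positivity
    have h1 := sigNorm_trunc_le_iff.1 (h T x hx) T le_rfl
    have h2 : sigNorm (trunc T x) ≤ ENNReal.ofReal B := sigNorm_trunc_le_iff.2 fun s hs => by
      rw [← ofReal_norm]; exact ENNReal.ofReal_le_ofReal (hB s hs)
    have h3 := h1.trans (mul_le_mul_right h2 _)
    rwa [← ofReal_norm, ← ENNReal.ofReal_mul hC,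
      ENNReal.ofReal_le_ofReal_iff (by positivity)] at h3
  · intro h T x _
    refine sigNorm_trunc_le_iff.2 fun s hs => ?_
    have hfin := sigNorm_trunc_ne_top x T
    have h1 := h s x (sigNorm (trunc T x)).toReal fun u hu => by
      have := (sigNorm_trunc_le_iff (x := x) (T := T)).1 le_rfl u (hu.trans hs)
      rw [← ofReal_norm] at this
      exact (ENNReal.ofReal_le_iff_le_toReal hfin).1 this
    rw [← ofReal_norm]
    refine (ENNReal.ofReal_le_ofReal h1).trans ?_
    rw [ENNReal.ofReal_mul hC, ENNReal.ofReal_toReal hfin]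

theorem stable_of_bound {H : Sys E F} {C : ℝ} (hC : 0 ≤ C)
    (h : ∀ (T : ℕ) (x : ℕ → E) (B : ℝ), (∀ s ≤ T, ‖x s‖ ≤ B) → ‖H x T‖ ≤ C * B) : Stable H :=
  ((indNorm_le_iff hC).2 h).trans_lt ENNReal.ofReal_lt_top

theorem Stable.bound {H : Sys E F} (hH : Stable H) {T : ℕ} {x : ℕ → E} {B : ℝ}
    (hB : ∀ s ≤ T, ‖x s‖ ≤ B) : ‖H x T‖ ≤ (indNorm H).toReal * B :=
  (indNorm_le_iff ENNReal.toReal_nonneg).1 (ENNReal.ofReal_toReal hH.ne).ge T x B hB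

theorem toReal_indNorm_le {H : Sys E F} {C : ℝ} (hC : 0 ≤ C)
    (h : ∀ (T : ℕ) (x : ℕ → E) (B : ℝ), (∀ s ≤ T, ‖x s‖ ≤ B) → ‖H x T‖ ≤ C * B) :
    (indNorm H).toReal ≤ C :=
  ENNReal.toReal_le_of_le_ofReal hC ((indNorm_le_iff hC).2 h)

theorem causal_iff {H : Sys E F} :
    Causal H ↔ ∀ (t : ℕ) (x y : ℕ → E), (∀ s ≤ t, x s = y s) → H x t = H y t := by
  constructor
  · intro h t x y hxy
    have e : trunc t x = trunc t y := by
      funext s; simp only [trunc]; split_ifs with hs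
      · exact hxy s hs
      · rfl
    have h1 := congrFun (h t x) t
    have h2 := congrFun (h t y) t
    rw [e] at h1
    simpa [trunc] using h1.trans h2.symm
  · intro h T x
    funext t
    simp only [trunc]
    split_ifs with ht
    · exact h t _ _ fun s hs => (if_pos (hs.trans ht)).symm
    · rfl

theorem Causal.comp {H : Sys F G} {K : Sys E F} (hH : Causal H) (hK : Causal K) :
    Causal (H ∘ₗ K) := by
  rw [causal_iff] at *
  exact fun t x y hxy => hH t _ _ fun s hs => hK s _ _ fun u hu => hxy u (hu.trans hs)

theorem Stable.comp {H : Sys F G} {K : Sys E F} (hH : Stable H) (hK : Stable K) :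
    Stable (H ∘ₗ K) := by
  refine stable_of_bound (C := (indNorm H).toReal * (indNorm K).toReal) (by positivity) ?_
  intro T x B hB
  rw [mul_assoc]
  exact hH.bound fun s hs => hK.bound fun u hu => hB u (hu.trans hs)

theorem Causal.apply_eq_sum {H : Sys E F} (hH : Causal H) (x : ℕ → E) (t : ℕ) :
    H x t = ∑ s ∈ Finset.range (t + 1), H (Pi.single s (x s)) t := by
  rw [causal_iff] at hH
  rw [hH t x (∑ s ∈ Finset.range (t + 1), Pi.single s (x s)), map_sum, Finset.sum_apply]
  intro s hs
  rw [Finset.sum_apply, Finset.sum_eq_single s]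
  · simp
  · intro b _ hb; exact Pi.single_eq_of_ne hb.symm _
  · intro h; exact absurd (Finset.mem_range.2 (by omega)) h

/-- Each output sample depends linearly on finitely many input samples, hence continuously in the
product topology. This lets a causal system pass through an infinite sum. -/
theorem Causal.continuous [FiniteDimensional ℝ E] {H : Sys E F} (hH : Causal H) :
    Continuous H := by
  refine continuous_pi fun t => ?_
  rw [show (fun x => H x t) = fun x => ∑ s ∈ Finset.range (t + 1), H (Pi.single s (x s)) t from
    funext fun x => hH.apply_eq_sum x t]
  refine continuous_finsetSum _ fun s _ => ?_
  let L : E →ₗ[ℝ] F := LinearMap.proj t ∘ₗ H ∘ₗ LinearMap.single ℝ (fun _ : ℕ => E) s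
  exact L.continuous_of_finiteDimensional.comp (continuous_apply s)

/-- The small gain theorem. -/
theorem hasStableInverse_of_bound [FiniteDimensional ℝ E] {H : Sys E E} (hH : Causal H)
    {γ : ℝ} (hγ0 : 0 ≤ γ) (hγ : γ < 1)
    (h : ∀ (T : ℕ) (x : ℕ → E) (B : ℝ), (∀ s ≤ T, ‖x s‖ ≤ B) → ‖H x T‖ ≤ γ * B) :
    HasStableInverse (LinearMap.id - H) := by
  have hcomplete : CompleteSpace E := FiniteDimensional.complete ℝ E
  have hpow : ∀ (k T : ℕ) (x : ℕ → E) (B : ℝ), (∀ s ≤ T, ‖x s‖ ≤ B) →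
      ‖(H ^ k) x T‖ ≤ γ ^ k * B := by
    intro k
    induction k with
    | zero => intro T x B hB; simpa using hB T le_rfl
    | succ k ih =>
      intro T x B hB
      rw [pow_succ', pow_succ', mul_assoc]
      exact h T _ _ fun s hs => ih s x B fun u hu => hB u (hu.trans hs)
  have hcpow : ∀ k : ℕ, Causal (H ^ k) := by
    intro k
    induction k with
    | zero => exact causal_iff.2 fun t x y hxy => by simpa using hxy t le_rfl
    | succ k ih => rw [pow_succ]; exact ih.comp hH
  have hbd : ∀ (x : ℕ → E) (T : ℕ), ∃ B, ∀ s ≤ T, ‖x s‖ ≤ B := fun x T =>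
    ⟨∑ s ∈ Finset.range (T + 1), ‖x s‖, fun s hs =>
      Finset.single_le_sum (f := fun s => ‖x s‖) (fun _ _ => norm_nonneg _)
        (Finset.mem_range.2 (by omega))⟩
  have hgeo := summable_geometric_of_lt_one hγ0 hγ
  have hsum : ∀ x : ℕ → E, Summable fun k => (H ^ k) x := fun x => by
    refine Pi.summable.2 fun t => ?_
    obtain ⟨B, hB⟩ := hbd x t
    exact Summable.of_norm_bounded (hgeo.mul_right B) fun k => hpow k t x B hB
  -- The Neumann series converges at each time separately, so no bound on the whole signal `x` is
  -- needed.
  let K : Sys E E :=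
    { toFun := fun x => ∑' k, (H ^ k) x
      map_add' := fun x y => by
        simp only [map_add]
        exact (hsum x).tsum_add (hsum y)
      map_smul' := fun c x => by
        simp only [map_smul, RingHom.id_apply]
        exact (hsum x).tsum_const_smul c }
  have hK : ∀ x t, K x t = ∑' k, (H ^ k) x t := fun x t => tsum_apply (hsum x)
  have hshift : ∀ x, K x = x + ∑' k, (H ^ (k + 1)) x := fun x => by
    have := (hsum x).tsum_eq_zero_add
    rwa [pow_zero] at this
  refine ⟨K, ?_, ?_, ?_, ?_⟩
  · rw [causal_iff]
    intro t x y hxy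
    rw [hK, hK]
    exact tsum_congr fun k => causal_iff.1 (hcpow k) t x y hxy
  · refine stable_of_bound (C := (1 - γ)⁻¹) (by rw [inv_nonneg]; linarith) ?_
    intro T x B hB
    rw [hK, ← tsum_geometric_of_lt_one hγ0 hγ, ← tsum_mul_right]
    exact tsum_of_norm_bounded (hgeo.mul_right B).hasSum fun k => hpow k T x B hB
  · refine LinearMap.ext fun x => ?_
    have e : K (H x) = ∑' k, (H ^ (k + 1)) x := by
      change ∑' k, (H ^ k) (H x) = _
      simp only [pow_succ, Module.End.mul_apply]
    rw [LinearMap.comp_apply, LinearMap.sub_apply, LinearMap.id_apply, map_sub, e, hshift x,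
      add_sub_cancel_right]
  · refine LinearMap.ext fun x => ?_
    have e : H (K x) = ∑' k, (H ^ (k + 1)) x := by
      have := ((hsum x).hasSum.map H hH.continuous).tsum_eq
      change H (∑' k, (H ^ k) x) = _
      rw [← this]
      simp only [pow_succ', Module.End.mul_apply, Function.comp_def]
    rw [LinearMap.comp_apply, LinearMap.sub_apply, LinearMap.id_apply, e, hshift x,
      add_sub_cancel_right, LinearMap.id_apply]

theorem causal_id : Causal (LinearMap.id : Sys E E) := by
  exact causal_iff.2 fun t x y hxy => hxy t le_rfl

theorem stable_id : Stable (LinearMap.id : Sys E E) :=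
  stable_of_bound (C := 1) zero_le_one fun T x B hB => by simpa using hB T le_rfl

theorem hasStableInverse_id : HasStableInverse (LinearMap.id : Sys E E) :=
  ⟨LinearMap.id, causal_id, stable_id, by simp, by simp⟩

/-- Invertibility is invariant under similarity by causal stable systems. -/
theorem HasStableInverse.conj {H P Q : Sys E E} (hH : HasStableInverse H) (hP : Causal P)
    (hP' : Stable P) (hQ : Causal Q) (hQ' : Stable Q) (hPQ : P ∘ₗ Q = LinearMap.id)
    (hQP : Q ∘ₗ P = LinearMap.id) : HasStableInverse (P ∘ₗ H ∘ₗ Q) := by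
  obtain ⟨K, hK, hK', h1, h2⟩ := hH
  have a1 : ∀ x, P (Q x) = x := fun x => LinearMap.congr_fun hPQ x
  have a2 : ∀ x, Q (P x) = x := fun x => LinearMap.congr_fun hQP x
  have a3 : ∀ x, K (H x) = x := fun x => LinearMap.congr_fun h1 x
  have a4 : ∀ x, H (K x) = x := fun x => LinearMap.congr_fun h2 x
  refine ⟨P ∘ₗ K ∘ₗ Q, hP.comp (hK.comp hQ), hP'.comp (hK'.comp hQ'), ?_, ?_⟩ <;>
  · refine LinearMap.ext fun x => ?_
    simp [a1, a2, a3, a4]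

end Norms

/-! ### Scalar entries and constant diagonal systems -/

section Entries

variable {n : ℕ}

theorem entry_apply (H : MSys n) (i j : Fin n) (u : ℕ → ℝ) (t : ℕ) :
    entry H i j u t = H (fun s => Pi.single j (u s)) t i := rfl

theorem apply_eq_sum_entry (H : MSys n) (x : ℕ → Fin n → ℝ) (t : ℕ) (i : Fin n) :
    H x t i = ∑ j, entry H i j (fun s => x s j) t := by
  have hx : x = ∑ j, (fun s => Pi.single j (x s j) : ℕ → Fin n → ℝ) := by
    funext s k
    simp [Finset.sum_apply, Pi.single_apply]
  conv_lhs => rw [hx]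
  rw [map_sum, Finset.sum_apply, Finset.sum_apply]
  rfl

theorem Causal.entry {H : MSys n} (hH : Causal H) (i j : Fin n) :
    Causal (NuMeasure.entry H i j) := by
  rw [causal_iff] at *
  intro t x y hxy
  rw [entry_apply, entry_apply, hH t _ (fun s => Pi.single j (y s)) fun s hs => by rw [hxy s hs]]

theorem Stable.entry_le {H : MSys n} (hH : Stable H) (i j : Fin n) :
    indNorm (NuMeasure.entry H i j) ≤ indNorm H := by
  rw [← ENNReal.ofReal_toReal hH.ne]
  refine (indNorm_le_iff ENNReal.toReal_nonneg).2 fun T x B hB => ?_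
  rw [entry_apply]
  refine (norm_le_pi_norm _ i).trans (hH.bound fun s hs => ?_)
  rw [Pi.norm_single]
  exact hB s hs

theorem Stable.entry {H : MSys n} (hH : Stable H) (i j : Fin n) :
    Stable (NuMeasure.entry H i j) :=
  (hH.entry_le i j).trans_lt hH

theorem diag_apply {Δ : MSys n} (h : ∀ i j, i ≠ j → entry Δ i j = 0) (x : ℕ → Fin n → ℝ)
    (t : ℕ) (i : Fin n) : Δ x t i = entry Δ i i (fun s => x s i) t := by
  rw [apply_eq_sum_entry, Finset.sum_eq_single i]
  · intro j _ hj; simp [h i j hj.symm]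
  · simp

theorem static_apply (d : Fin n → ℝ) (x : ℕ → Fin n → ℝ) (t : ℕ) (i : Fin n) :
    static (Matrix.diagonal d) x t i = d i * x t i := by
  simp [static, Matrix.mulVec_diagonal]

theorem causal_static (D : Matrix (Fin n) (Fin n) ℝ) : Causal (static D) := by
  rw [causal_iff]
  intro t x y hxy
  simp [static, hxy t le_rfl]

theorem stable_static (d : Fin n → ℝ) : Stable (static (Matrix.diagonal d)) := by
  refine stable_of_bound (C := ‖d‖) (norm_nonneg _) fun T x B hB => ?_
  have hB0 : 0 ≤ B := (norm_nonneg _).trans (hB 0 (Nat.zero_le _))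
  refine (pi_norm_le_iff_of_nonneg (by positivity)).2 fun i => ?_
  rw [static_apply, norm_mul]
  exact mul_le_mul (norm_le_pi_norm d i) ((norm_le_pi_norm _ i).trans (hB T le_rfl))
    (norm_nonneg _) (norm_nonneg _)

theorem static_comp_static_inv {d : Fin n → ℝ} (hd : ∀ i, d i ≠ 0) :
    static (Matrix.diagonal d) ∘ₗ static (Matrix.diagonal fun i => (d i)⁻¹) = LinearMap.id := by
  refine LinearMap.ext fun x => ?_
  funext t i
  simp [static_apply, hd i]

theorem static_inv_comp_static {d : Fin n → ℝ} (hd : ∀ i, d i ≠ 0) :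
    static (Matrix.diagonal fun i => (d i)⁻¹) ∘ₗ static (Matrix.diagonal d) = LinearMap.id := by
  refine LinearMap.ext fun x => ?_
  funext t i
  simp [static_apply, hd i]

theorem HasStableInverse.static_conj {H : MSys n} (hH : HasStableInverse H) {d : Fin n → ℝ}
    (hd : ∀ i, d i ≠ 0) :
    HasStableInverse
      (static (Matrix.diagonal d) ∘ₗ H ∘ₗ static (Matrix.diagonal fun i => (d i)⁻¹)) :=
  hH.conj (causal_static _) (stable_static _) (causal_static _) (stable_static _)
    (static_comp_static_inv hd) (static_inv_comp_static hd)

end Entries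

/-! ### Scaling, conjugation and comparison with `μ` -/

section Uncertainty

variable {n : ℕ}

theorem indNorm_smul_le {E F : Type*} [NormedAddCommGroup E] [NormedSpace ℝ E]
    [NormedAddCommGroup F] [NormedSpace ℝ F] {H : Sys E F} (hH : Stable H) (a : ℝ) :
    indNorm (a • H) ≤ ENNReal.ofReal |a| * indNorm H := by
  rw [← ENNReal.ofReal_toReal hH.ne, ← ENNReal.ofReal_mul (abs_nonneg a)]
  refine (indNorm_le_iff (by positivity)).2 fun T x B hB => ?_
  rw [LinearMap.smul_apply, Pi.smul_apply, norm_smul, Real.norm_eq_abs, mul_assoc]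
  exact mul_le_mul_of_nonneg_left (hH.bound hB) (abs_nonneg a)

theorem entry_smul (a : ℝ) (H : MSys n) (i j : Fin n) : entry (a • H) i j = a • entry H i j :=
  rfl

theorem uncertainty_smul {Δ : MSys n} (hΔ : Δ ∈ uncertainty n) (a : ℝ) :
    a • Δ ∈ uncertainty n := by
  obtain ⟨h1, h2, h3⟩ := hΔ
  refine ⟨?_, ?_, fun i j hij => by rw [entry_smul, h3 i j hij, smul_zero]⟩
  · rw [causal_iff] at *
    intro t x y hxy
    simp [h1 t x y hxy]
  · exact (indNorm_smul_le h2 a).trans_lt (ENNReal.mul_lt_top ENNReal.ofReal_lt_top h2)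

/-- Comparison of the values of `ν` by comparison of destabilizing uncertainties. -/
theorem nu_le_mul_nu {G G' : MSys n} {c : ℝ≥0∞} (hc : c ≠ 0) (hc' : c ≠ ∞)
    (h : ∀ Δ ∈ destabilizing G', ∃ Δ' ∈ destabilizing G,
      ∑ i, indNorm (entry Δ' i i) ≤ c * ∑ i, indNorm (entry Δ i i)) :
    nu G' ≤ c * nu G := by
  have key : (⨅ Δ ∈ destabilizing G, ∑ i, indNorm (entry Δ i i)) ≤
      c * ⨅ Δ ∈ destabilizing G', ∑ i, indNorm (entry Δ i i) := by
    simp only [ENNReal.mul_iInf_of_ne hc hc']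
    refine le_iInf₂ fun Δ hΔ => ?_
    obtain ⟨Δ', hΔ', hle⟩ := h Δ hΔ
    exact (iInf₂_le Δ' hΔ').trans hle
  unfold nu
  calc _ = c * (c * ⨅ Δ ∈ destabilizing G', ∑ i, indNorm (entry Δ i i))⁻¹ := by
        rw [ENNReal.mul_inv (Or.inl hc) (Or.inl hc'), ← mul_assoc,
          ENNReal.mul_inv_cancel hc hc', one_mul]
    _ ≤ _ := mul_le_mul_right (ENNReal.inv_le_inv.2 key) c

theorem nu_smul_le (G : MSys n) {a : ℝ} (ha : a ≠ 0) :
    nu (a • G) ≤ ENNReal.ofReal |a| * nu G := by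
  refine nu_le_mul_nu (by simpa using ha) ENNReal.ofReal_ne_top fun Δ hΔ => ?_
  obtain ⟨h1, h2⟩ := hΔ
  refine ⟨a • Δ, ⟨uncertainty_smul h1 a, ?_⟩, ?_⟩
  · rwa [LinearMap.comp_smul, ← LinearMap.smul_comp]
  · rw [Finset.mul_sum]
    exact Finset.sum_le_sum fun i _ => by
      rw [entry_smul]; exact indNorm_smul_le (h1.2.1.entry i i) a

theorem nu_smul (G : MSys n) (a : ℝ) : nu (a • G) = ENNReal.ofReal |a| * nu G := by
  rcases eq_or_ne a 0 with rfl | ha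
  · have : destabilizing (0 : MSys n) = ∅ := by
      refine Set.eq_empty_of_forall_notMem fun Δ hΔ => hΔ.2 ?_
      simpa using hasStableInverse_id
    rw [zero_smul]
    simp [nu, this]
  · refine le_antisymm (nu_smul_le G ha) ?_
    -- The reverse inequality is the same bound for `a • G` and the factor `a⁻¹`.
    have h := nu_smul_le (a • G) (inv_ne_zero ha)
    rw [smul_smul, inv_mul_cancel₀ ha, one_smul] at h
    refine (mul_le_mul_right h _).trans ?_
    rw [← mul_assoc, ← ENNReal.ofReal_mul (abs_nonneg a), abs_inv,
      mul_inv_cancel₀ (abs_ne_zero.2 ha), ENNReal.ofReal_one, one_mul]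

theorem static_comm {Δ : MSys n} (hΔ : ∀ i j, i ≠ j → entry Δ i j = 0) (d : Fin n → ℝ) :
    Δ ∘ₗ static (Matrix.diagonal d) = static (Matrix.diagonal d) ∘ₗ Δ := by
  refine LinearMap.ext fun x => ?_
  funext t i
  rw [LinearMap.comp_apply, LinearMap.comp_apply, static_apply, diag_apply hΔ, diag_apply hΔ]
  have : (fun s => static (Matrix.diagonal d) x s i) = d i • fun s => x s i := by
    funext s; simp [static_apply]
  rw [this, map_smul, Pi.smul_apply, smul_eq_mul]

/-- By `static_comm`, a stable inverse of `I - GΔ` conjugates to one for the scaled loop. The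
opposite inclusion comes from using `d⁻¹` on the conjugated system. -/
theorem destabilizing_conj_subset (G : MSys n) {d : Fin n → ℝ} (hd : ∀ i, d i ≠ 0) :
    destabilizing (static (Matrix.diagonal d) ∘ₗ G ∘ₗ static (Matrix.diagonal fun i => (d i)⁻¹)) ⊆
      destabilizing G := by
  rintro Δ ⟨h1, h2⟩
  refine ⟨h1, fun h => h2 ?_⟩
  have e := h.static_conj hd
  rwa [LinearMap.sub_comp, LinearMap.comp_sub, LinearMap.id_comp, static_comp_static_inv hd,
    LinearMap.comp_assoc, static_comm h1.2.2, ← LinearMap.comp_assoc, ← LinearMap.comp_assoc,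
    LinearMap.comp_assoc _ G] at e

theorem nu_conj (G : MSys n) {D : Matrix (Fin n) (Fin n) ℝ} (hD : D ∈ posDiag n) :
    nu (static D ∘ₗ G ∘ₗ static D⁻¹) = nu G := by
  obtain ⟨d, hd, rfl⟩ := hD
  have hd0 : ∀ i, d i ≠ 0 := fun i => (hd i).ne'
  have hinv : (Matrix.diagonal d)⁻¹ = Matrix.diagonal fun i => (d i)⁻¹ :=
    Matrix.inv_eq_right_inv (by simp [Matrix.diagonal_mul_diagonal, hd0])
  have e : destabilizing (static (Matrix.diagonal d) ∘ₗ G ∘ₗ static (Matrix.diagonal d)⁻¹) =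
      destabilizing G := by
    rw [hinv]
    refine (destabilizing_conj_subset G hd0).antisymm ?_
    have h := destabilizing_conj_subset
      (static (Matrix.diagonal d) ∘ₗ G ∘ₗ static (Matrix.diagonal fun i => (d i)⁻¹))
      (d := fun i => (d i)⁻¹) fun i => inv_ne_zero (hd0 i)
    simp only [inv_inv] at h
    have hG : static (Matrix.diagonal fun i => (d i)⁻¹) ∘ₗ
        (static (Matrix.diagonal d) ∘ₗ G ∘ₗ static (Matrix.diagonal fun i => (d i)⁻¹)) ∘ₗ
          static (Matrix.diagonal d) = G := by
      rw [LinearMap.comp_assoc, LinearMap.comp_assoc, static_inv_comp_static hd0,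
        ← LinearMap.comp_assoc, static_inv_comp_static hd0, LinearMap.comp_id, LinearMap.id_comp]
    rwa [hG] at h
  rw [nu, nu, e]

theorem indNorm_le_sum {Δ : MSys n} (hΔ : Δ ∈ uncertainty n) :
    indNorm Δ ≤ ∑ i, indNorm (entry Δ i i) := by
  have h0 : ∀ i, 0 ≤ (indNorm (entry Δ i i)).toReal := fun i => ENNReal.toReal_nonneg
  have e : ∑ i, indNorm (entry Δ i i) =
      ENNReal.ofReal (∑ i, (indNorm (entry Δ i i)).toReal) := by
    rw [ENNReal.ofReal_sum_of_nonneg fun i _ => h0 i]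
    exact Finset.sum_congr rfl fun i _ => (ENNReal.ofReal_toReal (hΔ.2.1.entry i i).ne).symm
  rw [e]
  refine (indNorm_le_iff (Finset.sum_nonneg fun i _ => h0 i)).2 fun T x B hB => ?_
  have hB0 : 0 ≤ B := (norm_nonneg _).trans (hB 0 (Nat.zero_le _))
  refine (pi_norm_le_iff_of_nonneg (mul_nonneg (Finset.sum_nonneg fun i _ => h0 i) hB0)).2
    fun i => ?_
  rw [diag_apply hΔ.2.2]
  refine ((hΔ.2.1.entry i i).bound fun s hs => (norm_le_pi_norm _ i).trans (hB s hs)).trans ?_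
  exact mul_le_mul_of_nonneg_right
    (Finset.single_le_sum (f := fun i => (indNorm (entry Δ i i)).toReal) (fun i _ => h0 i)
      (Finset.mem_univ i)) hB0

theorem nu_le_mu (G : MSys n) : nu G ≤ mu G :=
  ENNReal.inv_le_inv.2 (iInf₂_mono fun _ hΔ => indNorm_le_sum hΔ.1)

theorem mu_div_le_nu (G : MSys n) : mu G / (n : ℝ≥0∞) ≤ nu G := by
  rcases Nat.eq_zero_or_pos n with rfl | hn
  · have : destabilizing G = ∅ := by
      refine Set.eq_empty_of_forall_notMem fun Δ hΔ => hΔ.2 ?_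
      rw [Subsingleton.elim (LinearMap.id - G ∘ₗ Δ) LinearMap.id]
      exact hasStableInverse_id
    simp [mu, this]
  · have hn0 : (n : ℝ≥0∞) ≠ 0 := by simpa using hn.ne'
    have hn1 : (n : ℝ≥0∞) ≠ ∞ := ENNReal.natCast_ne_top n
    rw [mu, nu, div_eq_mul_inv, ← ENNReal.mul_inv (Or.inr hn1) (Or.inr hn0), ENNReal.inv_le_inv,
      mul_comm]
    simp only [ENNReal.mul_iInf_of_ne hn0 hn1]
    refine iInf₂_mono fun Δ hΔ => ?_
    refine (Finset.sum_le_card_nsmul _ _ (indNorm Δ) fun i _ => hΔ.1.2.1.entry_le i i).trans ?_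
    simp

end Uncertainty

/-! ### Upper bound: the structured small gain theorem -/

section SmallGain

variable {n : ℕ}

open Matrix in
/-- A non-negative matrix `A` such that `1 - s A` is invertible for all `s ∈ [0, 1]` admits a
strictly positive vector with `A v < v`. -/
theorem exists_weight {A : Matrix (Fin n) (Fin n) ℝ} (hA : ∀ i j, 0 ≤ A i j)
    (h : ∀ s ∈ Set.Icc (0 : ℝ) 1, IsUnit (1 - s • A)) :
    ∃ v : Fin n → ℝ, (∀ i, 0 < v i) ∧ ∀ i, (A *ᵥ v) i + 1 = v i := by
  let v : ℝ → Fin n → ℝ := fun s => (1 - s • A)⁻¹ *ᵥ 1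
  have hv : ∀ s ∈ Set.Icc (0 : ℝ) 1, ∀ i, v s i = 1 + s * (A *ᵥ v s) i := by
    intro s hs i
    have h1 : (1 - s • A) *ᵥ v s = 1 := by
      simp only [v, mulVec_mulVec]
      rw [mul_nonsing_inv _ ((isUnit_iff_isUnit_det _).1 (h s hs)), one_mulVec]
    have h2 := congrFun h1 i
    simp only [sub_mulVec, one_mulVec, smul_mulVec, Pi.sub_apply, Pi.smul_apply, smul_eq_mul,
      Pi.one_apply] at h2
    linarith
  -- Non-negativity improves itself to `≥ 1`, so the least coordinate of `v s` never lies in `[0,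
  -- 1)`.
  have hpos : ∀ s ∈ Set.Icc (0 : ℝ) 1, (∀ i, 0 ≤ v s i) → ∀ i, 1 ≤ v s i := by
    intro s hs h0 i
    rw [hv s hs i]
    have : 0 ≤ (A *ᵥ v s) i := by
      rw [mulVec, dotProduct]
      exact Finset.sum_nonneg fun j _ => mul_nonneg (hA i j) (h0 j)
    nlinarith [hs.1, mul_nonneg hs.1 this]
  have hcont : ContinuousOn v (Set.Icc 0 1) := by
    have hm : Continuous fun s : ℝ => 1 - s • A := by fun_prop
    have : v = fun s => (1 - s • A).det⁻¹ • ((1 - s • A).adjugate *ᵥ 1) := by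
      funext s
      simp only [v, inv_def, Ring.inverse_eq_inv', smul_mulVec]
    rw [this]
    refine ContinuousOn.smul (ContinuousOn.inv₀ hm.matrix_det.continuousOn fun s hs => ?_)
      (hm.matrix_adjugate.matrix_mulVec continuous_const).continuousOn
    exact ((isUnit_iff_isUnit_det _).1 (h s hs)).ne_zero
  have hall : ∀ i, 1 ≤ v 1 i := by
    rcases isEmpty_or_nonempty (Fin n) with he | hne
    · exact fun i => he.elim i
    have hune : (Finset.univ : Finset (Fin n)).Nonempty := Finset.univ_nonempty
    let f : ℝ → ℝ := fun s => Finset.univ.inf' hune fun i => v s i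
    have hf : ContinuousOn f (Set.Icc 0 1) :=
      ContinuousOn.finset_inf'_apply hune fun i _ => (continuous_apply i).comp_continuousOn hcont
    have hle : ∀ s i, f s ≤ v s i := fun s i => Finset.inf'_le _ (Finset.mem_univ i)
    have hf0 : 0 ≤ f 0 := Finset.le_inf' _ _ fun i _ => by
      rw [hv 0 ⟨le_rfl, zero_le_one⟩ i]; simp
    suffices h1 : 0 ≤ f 1 from
      hpos 1 ⟨zero_le_one, le_rfl⟩ fun i => h1.trans (hle 1 i)
    by_contra hlt
    -- If the least coordinate ended negative it would cross zero, a value just excluded.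
    obtain ⟨s, hs, hs0⟩ := intermediate_value_Icc' zero_le_one hf ⟨(not_le.1 hlt).le, hf0⟩
    have h1 := hpos s hs fun i => hs0.ge.trans (hle s i)
    have : 1 ≤ f s := Finset.le_inf' _ _ fun i _ => h1 i
    linarith
  refine ⟨v 1, fun i => zero_lt_one.trans_le (hall i), fun i => ?_⟩
  rw [hv 1 ⟨zero_le_one, le_rfl⟩ i]
  ring

open Matrix in
/-- The structured small gain theorem: a weight for a matrix of gain bounds gives stability. -/
theorem hasStableInverse_of_weight {H : MSys n} (hH : Causal H) (hH' : Stable H)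
    {A : Matrix (Fin n) (Fin n) ℝ} (hHA : ∀ i j, (indNorm (entry H i j)).toReal ≤ A i j)
    {v : Fin n → ℝ} (hv : ∀ i, 0 < v i) (hAv : ∀ i, (A *ᵥ v) i + 1 = v i) :
    HasStableInverse (LinearMap.id - H) := by
  have hv0 : ∀ i, v i ≠ 0 := fun i => (hv i).ne'
  let H' : MSys n := static (diagonal fun i => (v i)⁻¹) ∘ₗ H ∘ₗ static (diagonal v)
  have hcH' : Causal H' := (causal_static _).comp (hH.comp (causal_static _))
  -- As `S ≥ v i`, the slack `(A v) i = v i - 1` gives `(A v) i ≤ (1 - S⁻¹) * v i`, the contraction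
  -- factor used below. The summand 1 keeps `S ≥ 1` even for `n = 0`.
  set S : ℝ := 1 + ∑ i, v i with hS
  have hvS : ∀ i, v i ≤ S := fun i => by
    have := Finset.single_le_sum (f := v) (fun i _ => (hv i).le) (Finset.mem_univ i)
    linarith
  have hS1 : 1 ≤ S := by
    have := Finset.sum_nonneg (s := Finset.univ) fun i _ => (hv i).le
    linarith
  have hS0 : 0 < S := by linarith
  have hSinv : S⁻¹ ≤ 1 := inv_le_one_of_one_le₀ hS1
  have hinv : HasStableInverse (LinearMap.id - H') := by
    refine hasStableInverse_of_bound hcH' (γ := 1 - S⁻¹) (by linarith)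
      (by linarith [inv_pos.2 hS0]) fun T x B hB => ?_
    have hB0 : 0 ≤ B := (norm_nonneg _).trans (hB 0 (Nat.zero_le _))
    refine (pi_norm_le_iff_of_nonneg (mul_nonneg (by linarith) hB0)).2 fun i => ?_
    simp only [H', LinearMap.comp_apply, static_apply, norm_mul, norm_inv,
      Real.norm_of_nonneg (hv i).le]
    rw [inv_mul_le_iff₀ (hv i), apply_eq_sum_entry]
    have h1 : ∀ j, ‖entry H i j (fun s => static (diagonal v) x s j) T‖ ≤ A i j * v j * B := by
      intro j
      have h2 : ∀ s ≤ T, ‖static (diagonal v) x s j‖ ≤ v j * B := fun s hs => by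
        rw [static_apply, norm_mul, Real.norm_of_nonneg (hv j).le]
        exact mul_le_mul_of_nonneg_left ((norm_le_pi_norm _ j).trans (hB s hs)) (hv j).le
      refine ((hH'.entry i j).bound h2).trans ?_
      rw [mul_assoc]
      exact mul_le_mul_of_nonneg_right (hHA i j) (mul_nonneg (hv j).le hB0)
    refine (norm_sum_le _ _).trans ((Finset.sum_le_sum fun j _ => h1 j).trans ?_)
    rw [← Finset.sum_mul]
    have h3 : ∑ j, A i j * v j = v i - 1 := by
      have := hAv i
      rw [mulVec, dotProduct] at this
      linarith
    have h4 : v i * S⁻¹ ≤ 1 := by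
      rw [← div_eq_mul_inv, div_le_one hS0]; exact hvS i
    rw [h3, ← mul_assoc]
    exact mul_le_mul_of_nonneg_right (by nlinarith) hB0
  have e := hinv.static_conj hv0
  rw [LinearMap.sub_comp, LinearMap.comp_sub, LinearMap.id_comp, static_comp_static_inv hv0] at e
  have hHH' : static (diagonal v) ∘ₗ H' ∘ₗ static (diagonal fun i => (v i)⁻¹) = H := by
    simp only [H']
    rw [LinearMap.comp_assoc, LinearMap.comp_assoc, static_comp_static_inv hv0,
      ← LinearMap.comp_assoc, static_comp_static_inv hv0, LinearMap.comp_id, LinearMap.id_comp]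
  rwa [hHH'] at e

theorem entry_comp_diag (G : MSys n) {Δ : MSys n} (hΔ : ∀ i j, i ≠ j → entry Δ i j = 0)
    (i j : Fin n) : entry (G ∘ₗ Δ) i j = entry G i j ∘ₗ entry Δ j j := by
  refine LinearMap.ext fun u => ?_
  funext t
  rw [entry_apply, LinearMap.comp_apply, LinearMap.comp_apply, entry_apply]
  suffices e : Δ (fun s => Pi.single j (u s)) = fun s => Pi.single j (entry Δ j j u s) by rw [e]
  funext s k
  rw [diag_apply hΔ]
  rcases eq_or_ne k j with rfl | hk
  · simp
  · have : (fun s => (Pi.single j (u s) : Fin n → ℝ) k) = 0 := by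
      funext s; simp [hk]
    rw [this, map_zero, Pi.single_eq_of_ne hk]
    rfl

/-- A destabilizing uncertainty gives a singular constant matrix with no larger gains. -/
theorem nu_le_nuConst {G : MSys n} (hG : Causal G) (hG' : Stable G) :
    nu G ≤ nuConst (magMatrix G) := by
  refine ENNReal.inv_le_inv.2 (le_iInf₂ fun Δ hΔ => ?_)
  obtain ⟨⟨h1, h2, h3⟩, h4⟩ := hΔ
  let d : Fin n → ℝ := fun i => (indNorm (entry Δ i i)).toReal
  have hd : ∀ i, 0 ≤ d i := fun i => ENNReal.toReal_nonneg
  let A := magMatrix G * Matrix.diagonal d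
  have hAij : ∀ i j, A i j = (indNorm (entry G i j)).toReal * d j := fun i j => by
    simp [A, magMatrix]
  have hA : ∀ i j, 0 ≤ A i j := fun i j => by
    rw [hAij]; exact mul_nonneg ENNReal.toReal_nonneg (hd j)
  by_cases h : ∀ s ∈ Set.Icc (0 : ℝ) 1, IsUnit (1 - s • A)
  · obtain ⟨v, hv, hAv⟩ := exists_weight hA h
    refine absurd (hasStableInverse_of_weight (hG.comp h1) (hG'.comp h2) (fun i j => ?_) hv hAv) h4
    rw [hAij, entry_comp_diag G h3]
    refine toReal_indNorm_le (mul_nonneg ENNReal.toReal_nonneg (hd j)) fun T x B hB => ?_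
    rw [mul_assoc]
    exact (hG'.entry i j).bound fun s hs => (h2.entry j j).bound fun u hu => hB u (hu.trans hs)
  · push Not at h
    obtain ⟨s, ⟨hs0, hs1⟩, hs⟩ := h
    have hmem : Matrix.diagonal (s • d) ∈
        {Δ | Δ ∈ nonnegDiag n ∧ ¬ IsUnit (1 - magMatrix G * Δ)} := by
      refine ⟨⟨s • d, fun i => mul_nonneg hs0 (hd i), rfl⟩, ?_⟩
      rwa [Matrix.diagonal_smul, Matrix.mul_smul]
    refine (iInf₂_le (Matrix.diagonal (s • d)) hmem).trans ?_
    refine Finset.sum_le_sum fun i _ => ?_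
    rw [Matrix.diagonal_apply_eq, ← ofReal_norm, ← ENNReal.ofReal_toReal (h2.entry i i).ne,
      Pi.smul_apply, smul_eq_mul, Real.norm_of_nonneg (mul_nonneg hs0 (hd i))]
    exact ENNReal.ofReal_le_ofReal (mul_le_of_le_one_left (hd i) hs1)

end SmallGain

/-! ### Impulse responses of time-invariant scalar systems -/

section Impulse

theorem iterate_delay_apply {E : Type*} [Zero E] (x : ℕ → E) (s t : ℕ) :
    delay^[s] x (s + t) = x t := by
  induction s with
  | zero => simp
  | succ s ih => rw [Function.iterate_succ_apply', Nat.add_right_comm]; exact ih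

theorem iterate_delay_single (s : ℕ) :
    delay^[s] (Pi.single 0 1 : ℕ → ℝ) = Pi.single s 1 := by
  induction s with
  | zero => rfl
  | succ s ih =>
    rw [Function.iterate_succ_apply', ih]
    funext t
    cases t with
    | zero => simp [delay]
    | succ t => simp [delay, Pi.single_apply]

theorem TimeInvariant.entry {n : ℕ} {G : MSys n} (hG : TimeInvariant G) (i j : Fin n) :
    TimeInvariant (NuMeasure.entry G i j) := by
  intro x
  funext t
  have : (fun s => Pi.single j (delay x s) : ℕ → Fin n → ℝ) =
      delay fun s => Pi.single j (x s) := by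
    funext s
    cases s <;> simp [delay]
  rw [entry_apply, this, hG]
  cases t <;> rfl

/-- The convolution representation of a time-invariant causal scalar system. -/
theorem TimeInvariant.apply_eq_sum {H : Sys ℝ ℝ} (hH : TimeInvariant H) (hc : Causal H)
    (u : ℕ → ℝ) (t : ℕ) :
    H u t = ∑ s ∈ Finset.range (t + 1), u (t - s) * H (Pi.single 0 1) s := by
  have hit : ∀ (s : ℕ) (x : ℕ → ℝ), H (delay^[s] x) = delay^[s] (H x) := by
    intro s x
    induction s with
    | zero => rfl
    | succ s ih => rw [Function.iterate_succ_apply', hH, ih, Function.iterate_succ_apply']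
  rw [hc.apply_eq_sum, ← Finset.sum_flip]
  refine Finset.sum_congr rfl fun s hs => ?_
  have hst : s ≤ t := by have := Finset.mem_range.1 hs; omega
  have e : (Pi.single (t - s) (u (t - s)) : ℕ → ℝ) =
      u (t - s) • delay^[t - s] (Pi.single 0 1) := by
    rw [iterate_delay_single, ← Pi.single_smul, smul_eq_mul, mul_one]
  rw [e, map_smul, hit, Pi.smul_apply, smul_eq_mul]
  congr 1
  conv_lhs => rw [show t = (t - s) + s by omega]
  rw [show t - s + s - s = t - s by omega, iterate_delay_apply]

theorem abs_sign_le_one (x : ℝ) : |(SignType.sign x : ℝ)| ≤ 1 := by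
  rcases lt_trichotomy x 0 with h | h | h <;> simp [h]

/-- The induced norm of a time-invariant scalar system is the `ℓ₁` norm of its impulse response. -/
theorem TimeInvariant.hasSum_abs {H : Sys ℝ ℝ} (hH : TimeInvariant H) (hc : Causal H)
    (hs : Stable H) : HasSum (fun s => |H (Pi.single 0 1) s|) (indNorm H).toReal := by
  set h := H (Pi.single 0 1) with hh
  have hpart : ∀ L, ∑ s ∈ Finset.range L, |h s| ≤ (indNorm H).toReal := by
    intro L
    cases L with
    | zero => simp
    | succ t =>
      -- The time-reversed signs of the impulse response make the output at `t` equal to the partial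
      -- sum.
      have h1 := hs.bound (T := t) (x := fun τ => (SignType.sign (h (t - τ)) : ℝ)) (B := 1)
        fun s _ => abs_sign_le_one _
      rw [mul_one, hH.apply_eq_sum hc] at h1
      refine le_trans (le_of_eq ?_) ((le_abs_self _).trans h1)
      refine Finset.sum_congr rfl fun s hs => ?_
      have hst : s ≤ t := by have := Finset.mem_range.1 hs; omega
      rw [Nat.sub_sub_self hst, sign_mul_self]
  have hsum : Summable fun s => |h s| :=
    summable_of_sum_range_le (fun s => abs_nonneg _) hpart
  have hle : ∑' s, |h s| ≤ (indNorm H).toReal :=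
    Real.tsum_le_of_sum_range_le (fun s => abs_nonneg _) hpart
  have hge : (indNorm H).toReal ≤ ∑' s, |h s| := by
    refine toReal_indNorm_le (tsum_nonneg fun s => abs_nonneg _) fun T x B hB => ?_
    have hB0 : 0 ≤ B := (norm_nonneg _).trans (hB 0 (Nat.zero_le _))
    rw [hH.apply_eq_sum hc]
    refine (norm_sum_le _ _).trans (le_trans (Finset.sum_le_sum (g := fun s => |h s| * B)
      fun s _ => ?_) ?_)
    · rw [norm_mul, mul_comm]
      exact mul_le_mul_of_nonneg_left (hB _ (Nat.sub_le _ _)) (abs_nonneg _)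
    · rw [← Finset.sum_mul]
      exact mul_le_mul_of_nonneg_right (hsum.sum_le_tsum _ fun s _ => abs_nonneg _) hB0
  rw [le_antisymm hge hle]
  exact hsum.hasSum

/-- The output at time `t` if the last `L` inputs have the worst signs. -/
theorem TimeInvariant.le_apply {H : Sys ℝ ℝ} (hH : TimeInvariant H) (hc : Causal H)
    (hs : Stable H) {u : ℕ → ℝ} {t L : ℕ} {B : ℝ} (hL : L ≤ t + 1) (hB : ∀ τ ≤ t, |u τ| ≤ B)
    (hu : ∀ s < L, u (t - s) = SignType.sign (H (Pi.single 0 1) s) * B) :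
    B * (2 * ∑ s ∈ Finset.range L, |H (Pi.single 0 1) s| - (indNorm H).toReal) ≤ H u t := by
  have hB0 : 0 ≤ B := (abs_nonneg _).trans (hB 0 (Nat.zero_le _))
  have hM := sum_le_hasSum (Finset.range (t + 1)) (fun s _ => abs_nonneg _) (hH.hasSum_abs hc hs)
  rw [hH.apply_eq_sum hc]
  set h := H (Pi.single 0 1)
  simp only [Finset.range_eq_Ico] at hM ⊢
  rw [← Finset.sum_Ico_consecutive _ (Nat.zero_le L) hL] at hM ⊢
  have h1 : ∑ s ∈ Finset.Ico 0 L, u (t - s) * h s = B * ∑ s ∈ Finset.Ico 0 L, |h s| := by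
    rw [Finset.mul_sum]
    refine Finset.sum_congr rfl fun s hs => ?_
    rw [hu s (Finset.mem_Ico.1 hs).2, mul_right_comm, sign_mul_self, mul_comm]
  -- The unmatched older inputs can do no worse than subtract `B` times the tail of the `ℓ₁` norm.
  have h2 : -(B * ∑ s ∈ Finset.Ico L (t + 1), |h s|) ≤
      ∑ s ∈ Finset.Ico L (t + 1), u (t - s) * h s := by
    rw [Finset.mul_sum, ← Finset.sum_neg_distrib]
    refine Finset.sum_le_sum fun s _ => neg_le_of_abs_le ?_
    rw [abs_mul]
    exact mul_le_mul_of_nonneg_right (hB _ (Nat.sub_le _ _)) (abs_nonneg _)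
  rw [h1]
  have h3 := mul_le_mul_of_nonneg_left hM hB0
  linarith

end Impulse

/-! ### Lower bound: construction of a destabilizing uncertainty -/

section Destabilization

variable {n : ℕ}

/-- An unbounded signal in the loop, driven by a bounded one, yields a destabilizing
uncertainty: `δ_i` reproduces `ξ_i` from `z_i` by a time-varying gain on a past sample. -/
theorem exists_destabilizing_of_unbounded {G : MSys n} {ξ z : ℕ → Fin n → ℝ} {b : Fin n → ℝ}
    (hb : ∀ i, 0 ≤ b i) {C : ℝ} (hC : ∀ t, ‖(z - G ξ) t‖ ≤ C) (hz : ∀ B, ∃ t, B < ‖z t‖)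
    (hξ : ∀ t i, ∃ s ≤ t, |ξ t i| ≤ b i * |z s i|) :
    ∃ Δ ∈ destabilizing G, ∀ i, indNorm (entry Δ i i) ≤ ENNReal.ofReal (b i) := by
  choose σ hσ hσξ using hξ
  let a : ℕ → Fin n → ℝ := fun t i => ξ t i / z (σ t i) i
  have ha : ∀ t i, |a t i| ≤ b i := fun t i => by
    rw [abs_div]
    exact div_le_of_le_mul₀ (abs_nonneg _) (hb i) (hσξ t i)
  -- Where the past sample of `z` is zero, the bound forces `ξ t i = 0`, so the value `0` of the
  -- quotient is right.
  have haz : ∀ t i, a t i * z (σ t i) i = ξ t i := fun t i => by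
    refine div_mul_cancel_of_imp fun h0 => ?_
    have := hσξ t i
    rw [h0, abs_zero, mul_zero] at this
    exact abs_nonpos_iff.1 this
  let Δ : MSys n :=
    { toFun := fun u t i => a t i * u (σ t i) i
      map_add' := fun u v => by funext t i; simp [mul_add]
      map_smul' := fun c u => by
        funext t i
        simp only [Pi.smul_apply, smul_eq_mul, RingHom.id_apply]
        ring }
  have hΔ : ∀ u t i, Δ u t i = a t i * u (σ t i) i := fun _ _ _ => rfl
  have hΔc : Causal Δ := causal_iff.2 fun t x y hxy => by
    funext i
    rw [hΔ, hΔ, hxy _ (hσ t i)]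
  have hΔd : ∀ i j, i ≠ j → entry Δ i j = 0 := fun i j hij => by
    refine LinearMap.ext fun u => ?_
    funext t
    rw [entry_apply, hΔ, Pi.single_eq_of_ne hij, mul_zero]
    rfl
  have hΔs : Stable Δ := by
    refine stable_of_bound (C := ∑ i, b i) (Finset.sum_nonneg fun i _ => hb i) fun T x B hB => ?_
    have hB0 : 0 ≤ B := (norm_nonneg _).trans (hB 0 (Nat.zero_le _))
    refine (pi_norm_le_iff_of_nonneg
      (mul_nonneg (Finset.sum_nonneg fun i _ => hb i) hB0)).2 fun i => ?_
    rw [hΔ, norm_mul]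
    refine mul_le_mul ((ha T i).trans ?_) ((norm_le_pi_norm _ i).trans (hB _ (hσ T i)))
      (norm_nonneg _) (Finset.sum_nonneg fun i _ => hb i)
    exact Finset.single_le_sum (fun i _ => hb i) (Finset.mem_univ i)
  refine ⟨Δ, ⟨⟨hΔc, hΔs, hΔd⟩, ?_⟩, fun i => ?_⟩
  -- Since `Δ z = ξ`, a stable inverse would map the bounded signal `z - G ξ` to the unbounded `z`.
  · rintro ⟨K, -, hK, hK1, -⟩
    have hΔz : Δ z = ξ := by
      funext t i
      rw [hΔ, haz]
    have h1 : K (z - G ξ) = z := by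
      have := LinearMap.congr_fun hK1 z
      simpa [hΔz] using this
    obtain ⟨t, ht⟩ := hz ((indNorm K).toReal * C)
    have h2 := hK.bound (T := t) fun s _ => hC s
    rw [h1] at h2
    exact absurd h2 (not_le.2 ht)
  · refine (indNorm_le_iff (hb i)).2 fun T x B hB => ?_
    rw [entry_apply, hΔ, Pi.single_eq_same, norm_mul]
    exact mul_le_mul (ha T i) (hB _ (hσ T i)) (norm_nonneg _) (hb i)

/-- If `x ≤ M d x` for the magnitude matrix `M` of a time-invariant `G`, then signals with gains
slightly above `d` grow without bound in the loop. -/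
theorem TimeInvariant.exists_unbounded {G : MSys n} (hG : TimeInvariant G) (hc : Causal G)
    (hs : Stable G) {d x : Fin n → ℝ} (hd : ∀ i, 0 ≤ d i) (hx : ∀ i, 0 ≤ x i) {i₀ : Fin n}
    (hi₀ : 0 < x i₀) (hMx : ∀ i, x i ≤ ∑ j, magMatrix G i j * d j * x j) {c : ℝ} (hc1 : 1 < c) :
    ∃ (ξ z : ℕ → Fin n → ℝ) (C : ℝ), (∀ t, ‖(z - G ξ) t‖ ≤ C) ∧ (∀ B, ∃ t, B < ‖z t‖) ∧
      ∀ t i, ∃ s ≤ t, |ξ t i| ≤ c * d i * |z s i| := by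
  -- `r` is the growth per cycle. The gap between `r` and `c` pays for matching only the first `L`
  -- impulse response samples.
  obtain ⟨r, hr1, hrc⟩ := exists_between hc1
  have hn : 0 < n := Fin.pos i₀
  have hc0 : 0 < c := by linarith
  have hr0 : 0 < r := by linarith
  let h : Fin n → Fin n → ℕ → ℝ := fun i j => NuMeasure.entry G i j (Pi.single 0 1)
  let A : Fin n → ℝ := fun j => c * d j * x j
  have hA : ∀ j, 0 ≤ A j := fun j => mul_nonneg (mul_nonneg hc0.le (hd j)) (hx j)
  obtain ⟨L, hL1, hL⟩ : ∃ L, 1 ≤ L ∧ ∀ i, 0 < x i → r * x i ≤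
      ∑ j, A j * (2 * ∑ s ∈ Finset.range L, |h i j s| - magMatrix G i j) := by
    have key : ∀ᶠ L in Filter.atTop, ∀ i, 0 < x i → r * x i ≤
        ∑ j, A j * (2 * ∑ s ∈ Finset.range L, |h i j s| - magMatrix G i j) := by
      refine Filter.eventually_all.2 fun i => ?_
      by_cases hxi : 0 < x i
      · have ht : Filter.Tendsto
            (fun L => ∑ j, A j * (2 * ∑ s ∈ Finset.range L, |h i j s| - magMatrix G i j))
            Filter.atTop (nhds (∑ j, A j * (2 * magMatrix G i j - magMatrix G i j))) := by
          refine tendsto_finsetSum _ fun j _ => Filter.Tendsto.const_mul _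
            (Filter.Tendsto.sub_const (Filter.Tendsto.const_mul _ ?_) _)
          exact ((hG.entry i j).hasSum_abs (hc.entry i j) (hs.entry i j)).tendsto_sum_nat
        have hlt : r * x i < ∑ j, A j * (2 * magMatrix G i j - magMatrix G i j) := by
          have e : ∑ j, A j * (2 * magMatrix G i j - magMatrix G i j) =
              c * ∑ j, magMatrix G i j * d j * x j := by
            rw [Finset.mul_sum]
            exact Finset.sum_congr rfl fun j _ => by simp only [A]; ring
          rw [e]
          exact (mul_lt_mul_of_pos_right hrc hxi).trans_le
            (mul_le_mul_of_nonneg_left (hMx i) hc0.le)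
        exact (ht.eventually_const_le hlt).mono fun L h _ => h
      · exact Filter.Eventually.of_forall fun L h => absurd h hxi
    obtain ⟨L, hL, hL'⟩ := (key.and (Filter.eventually_ge_atTop 1)).exists
    exact ⟨L, hL', hL⟩
  -- Block `m` occupies the times `m * L + 1, …, (m + 1) * L` and is matched to output `m % n` at
  -- its last time. A cycle of `n` blocks serves every output once, and the amplitude is multiplied
  -- by `r` from each cycle to the next.
  let idx : ℕ → Fin n := fun m => ⟨m % n, Nat.mod_lt m hn⟩
  let ξ : ℕ → Fin n → ℝ := fun t j => if t = 0 then 0 else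
    SignType.sign (h (idx ((t - 1) / L)) j (((t - 1) / L + 1) * L - t)) *
      (A j * r ^ ((t - 1) / L / n))
  have hξ0 : ξ 0 = 0 := by funext j; simp [ξ]
  have hξle : ∀ t j, |ξ t j| ≤ A j * r ^ ((t - 1) / L / n) := by
    intro t j
    have h0 : 0 ≤ A j * r ^ ((t - 1) / L / n) := mul_nonneg (hA j) (by positivity)
    simp only [ξ]
    split_ifs
    · simpa using h0
    · rw [abs_mul, abs_of_nonneg h0]
      exact mul_le_of_le_one_left h0 (abs_sign_le_one _)
  have hout : ∀ (m : ℕ) (i : Fin n), idx m = i → 0 < x i →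
      r ^ (m / n + 1) * x i ≤ G ξ ((m + 1) * L) i := by
    intro m i hi hxi
    have hpow : 0 ≤ r ^ (m / n) := by positivity
    rw [apply_eq_sum_entry, pow_succ, mul_assoc]
    refine (mul_le_mul_of_nonneg_left (hL i hxi) hpow).trans ?_
    rw [Finset.mul_sum]
    refine Finset.sum_le_sum fun j _ => ?_
    rw [← mul_assoc, mul_comm (r ^ (m / n))]
    refine (hG.entry i j).le_apply (hc.entry i j) (hs.entry i j) ?_ ?_ ?_
    · nlinarith
    · intro τ hτ
      refine (hξle τ j).trans (mul_le_mul_of_nonneg_left ?_ (hA j))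
      refine pow_le_pow_right₀ hr1.le (Nat.div_le_div_right ?_)
      have : (τ - 1) / L < m + 1 := by
        rw [Nat.div_lt_iff_lt_mul (by omega)]
        have : 0 < (m + 1) * L := by positivity
        omega
      omega
    · intro s hsL
      have hLm : (m + 1) * L = m * L + L := by ring
      have h1 : (m + 1) * L - s ≠ 0 := by omega
      have h2 : ((m + 1) * L - s - 1) / L = m := by
        refine Nat.div_eq_of_lt_le ?_ ?_ <;> omega
      simp only [ξ, if_neg h1, h2, hi]
      rw [Nat.sub_sub_self (by omega)]
  -- The impulse `x` at time 0 is the bounded external signal that starts the loop. Since `ξ 0 = 0`,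
  -- it is all of `z 0`.
  let z : ℕ → Fin n → ℝ := G ξ + Pi.single 0 x
  have hz0 : z 0 = x := by
    have : G ξ 0 = G 0 0 := causal_iff.1 hc 0 _ _ fun s hs => by
      rw [Nat.le_zero.1 hs, hξ0]; rfl
    simp [z, this]
  have hzpos : ∀ t, t ≠ 0 → z t = G ξ t := fun t ht => by simp [z, ht]
  have hidx : ∀ (k : ℕ) (i : Fin n), idx (k * n + i) = i ∧ (k * n + i) / n = k := by
    intro k i
    refine ⟨Fin.ext ?_, ?_⟩
    · simp only [idx, Nat.mul_add_mod_self_right, Nat.mod_eq_of_lt i.2]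
    · rw [mul_comm, Nat.mul_add_div hn, Nat.div_eq_of_lt i.2, add_zero]
  have hzge : ∀ (k : ℕ) (i : Fin n), 0 < x i →
      r ^ (k + 1) * x i ≤ |z ((k * n + i + 1) * L) i| := by
    intro k i hxi
    have h1 := hout (k * n + i) i (hidx k i).1 hxi
    rw [(hidx k i).2] at h1
    rw [hzpos _ (by positivity)]
    exact h1.trans (le_abs_self _)
  refine ⟨ξ, z, ‖x‖, fun t => ?_, fun B => ?_, fun t i => ?_⟩
  · have : z - G ξ = Pi.single 0 x := by simp [z]
    rw [this]
    rcases eq_or_ne t 0 with rfl | ht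
    · simp
    · rw [Pi.single_eq_of_ne ht]; simp
  · obtain ⟨k, hk⟩ := pow_unbounded_of_one_lt (B / x i₀) hr1
    refine ⟨(k * n + i₀ + 1) * L, lt_of_lt_of_le ?_
      ((hzge k i₀ hi₀).trans (norm_le_pi_norm (z _) i₀))⟩
    rw [div_lt_iff₀ hi₀] at hk
    refine hk.trans_le (mul_le_mul_of_nonneg_right ?_ hi₀.le)
    exact pow_le_pow_right₀ hr1.le (Nat.le_succ k)
  · have hcd : 0 ≤ c * d i := mul_nonneg hc0.le (hd i)
    -- Cycle 0 of `ξ` is generated from `z 0 = x`, and cycle `k + 1` from the peak that `z` reached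
    -- in channel `i` during cycle `k`. Channels with `x i = 0` carry no input.
    rcases (hx i).eq_or_lt with hxi | hxi
    · refine ⟨0, Nat.zero_le _, (hξle t i).trans ?_⟩
      simp only [A, ← hxi, mul_zero, zero_mul]
      positivity
    rcases hk : (t - 1) / L / n with _ | k
    · refine ⟨0, Nat.zero_le _, (hξle t i).trans ?_⟩
      rw [hk, hz0, abs_of_pos hxi, pow_zero, mul_one]
    · refine ⟨(k * n + i + 1) * L, ?_, (hξle t i).trans ?_⟩
      · have h1 : (k + 1) * n ≤ (t - 1) / L := hk ▸ Nat.div_mul_le_self _ _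
        have h2 : k * n + i + 1 ≤ (t - 1) / L := by
          have := i.2
          nlinarith
        exact (Nat.mul_le_mul_right L h2).trans ((Nat.div_mul_le_self _ _).trans (Nat.sub_le _ _))
      · rw [hk]
        refine le_trans (le_of_eq ?_) (mul_le_mul_of_nonneg_left (hzge k i hxi) hcd)
        simp only [A]
        ring

open Matrix in
-- Taking absolute values in the kernel equation keeps an inequality because `M diag(d)` is
-- non-negative, and an inequality is all the growth construction needs.
theorem nuConst_le_nu {G : MSys n} (hG : TimeInvariant G) (hc : Causal G) (hs : Stable G) :
    nuConst (magMatrix G) ≤ nu G := by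
  refine ENNReal.inv_le_inv.2 (le_iInf₂ ?_)
  rintro _ ⟨⟨d, hd, rfl⟩, hsing⟩
  rw [isUnit_iff_isUnit_det, isUnit_iff_ne_zero, not_not] at hsing
  obtain ⟨w, hw0, hw⟩ := exists_mulVec_eq_zero_iff.2 hsing
  obtain ⟨i₀, hi₀⟩ := Function.ne_iff.1 hw0
  have hwi : ∀ i, w i = ∑ j, magMatrix G i j * d j * w j := fun i => by
    have := congrFun hw i
    rw [sub_mulVec, one_mulVec, Pi.sub_apply, Pi.zero_apply, sub_eq_zero] at this
    rw [this, mulVec, dotProduct]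
    simp only [mul_diagonal]
  have hM : ∀ i j, 0 ≤ magMatrix G i j := fun i j => ENNReal.toReal_nonneg
  have hMx : ∀ i, |w i| ≤ ∑ j, magMatrix G i j * d j * |w j| := fun i => by
    conv_lhs => rw [hwi i]
    refine (Finset.abs_sum_le_sum_abs _ _).trans (le_of_eq (Finset.sum_congr rfl fun j _ => ?_))
    rw [abs_mul, abs_of_nonneg (mul_nonneg (hM i j) (hd j))]
  have hsum : ∑ i, ‖diagonal d i i‖ₑ = ENNReal.ofReal (∑ i, d i) := by
    rw [ENNReal.ofReal_sum_of_nonneg fun i _ => hd i]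
    refine Finset.sum_congr rfl fun i _ => ?_
    rw [diagonal_apply_eq, ← ofReal_norm, Real.norm_of_nonneg (hd i)]
  have key : ∀ c : ℝ, 1 < c →
      (⨅ Δ ∈ destabilizing G, ∑ i, indNorm (entry Δ i i)) ≤ ENNReal.ofReal (c * ∑ i, d i) := by
    intro c hc1
    obtain ⟨ξ, z, C, h1, h2, h3⟩ := hG.exists_unbounded hc hs hd (fun i => abs_nonneg (w i))
      (abs_pos.2 hi₀) hMx hc1
    have hcd : ∀ i, 0 ≤ c * d i := fun i => mul_nonneg (by linarith) (hd i)
    obtain ⟨Δ, hΔ, hle⟩ := exists_destabilizing_of_unbounded hcd h1 h2 h3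
    refine (iInf₂_le Δ hΔ).trans ?_
    rw [Finset.mul_sum, ENNReal.ofReal_sum_of_nonneg fun i _ => hcd i]
    exact Finset.sum_le_sum fun i _ => hle i
  rw [hsum]
  -- The construction needs gains strictly above `d`, so the bound for `d` itself is reached only in
  -- the limit `c → 1`.
  have ht : Filter.Tendsto (fun c : ℝ => ENNReal.ofReal (c * ∑ i, d i))
      (nhdsWithin 1 (Set.Ioi 1)) (nhds (ENNReal.ofReal (1 * ∑ i, d i))) :=
    ((ENNReal.continuous_ofReal.comp (continuous_mul_const _)).tendsto 1).mono_left
      nhdsWithin_le_nhds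
  rw [one_mul] at ht
  exact ge_of_tendsto ht (Filter.eventually_of_mem self_mem_nhdsWithin key)

end Destabilization

end NuMeasure

theorem mainTheorem2 (n : ℕ) (G : NuMeasure.MSys n)
    (hcausal : NuMeasure.Causal G) (hstable : NuMeasure.Stable G) :
    (NuMeasure.TimeInvariant G →
      NuMeasure.nu G = NuMeasure.nuConst (NuMeasure.magMatrix G)) ∧
    (∀ a : ℝ, NuMeasure.nu (a • G) = ENNReal.ofReal |a| * NuMeasure.nu G) ∧
    (∀ D ∈ NuMeasure.posDiag n,
      NuMeasure.nu (NuMeasure.static D ∘ₗ G ∘ₗ NuMeasure.static D⁻¹) = NuMeasure.nu G) ∧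
    (NuMeasure.mu G / (n : ENNReal) ≤ NuMeasure.nu G ∧ NuMeasure.nu G ≤ NuMeasure.mu G) :=
  ⟨fun hG => (NuMeasure.nu_le_nuConst hcausal hstable).antisymm
      (NuMeasure.nuConst_le_nu hG hcausal hstable),
    NuMeasure.nu_smul G, fun _ hD => NuMeasure.nu_conj G hD,
    NuMeasure.mu_div_le_nu G, NuMeasure.nu_le_mu G⟩
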